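/- Let $p\ge 1$. A multivalued operator on $\mathbb R^2$ (identified with its graph $T\subset\mathbb R^2\times\mathbb R^2$) is \emph{$p$-cyclically monotone} if $\sum_{i=0}^{p}\langle x_{i+1}-x_i,x_i^*\rangle\le 0$ for all $(x_0,x_0^*),\dots,(x_p,x_p^*)\in T$, where $x_{p+1}=x_0$, and \emph{maximal} $p$-cyclically monotone if moreover its graph is not properly contained in the graph of another $p$-cyclically monotone operator. Its \emph{$p$-polar} $T^{\mu_p}$ is the set of all $(x_0,x_0^*)$ such that $\sum_{i=0}^{p}\langle x_{i+1}-x_i,x_i^*\rangle\le 0$ for all $(x_1,x_1^*),\dots,(x_p,x_p^*)\in T$, where again $x_{p+1}=x_0$. Take the starting points $$\begin{aligned} x_1&=(0,0),&x_1^*&=(-1,-\tfrac12),\qquad & x_2&=(1,0),&x_2^*&=(0,1),\\ x_3&=(0,1),&x_3^*&=(-1,0),& x_4&=(-1,0),&x_4^*&=(-2,-2),\\ x_5&=(0,-1),&x_5^*&=(0,-1), \end{aligned}$$ and put $T_0=\{(x_i,x_i^*):1\le i\le 5\}$, $T_k=\big(\{x_k\}\times T_{k-1}^{\mu_2}(x_k)\big)\cup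 T_{k-1}$ for $k=1,\dots,5$, and $T_6=T_5^{\mu_2}$. Then the following hold. (1) $T_6$ is the operator given explicitly by $$\begin{aligned} T_6(0,0)&=\{-1\}\times[-1,0],\\ T_6(1,0)&=\{(u,v):u\ge 0,\ -1-u\le v\le 1+u\},\\ T_6(0,1)&=\{(u,v):v\ge 0,\ -2-v\le u\le v-1\},\\ T_6(-1,0)&=\{(u,v):u\le -2,\ u\le v\le -2-u\},\\ T_6(0,-1)&=\{(u,v):v\le -1,\ v\le u\le -1-v\}, \end{aligned}$$ for all $t\in(0,1)$, $$\begin{aligned} T_6(1-t,t)&=\{(u,v):v=1+u,\ u\ge\max\{-2t,-1\}\},\\ T_6(-t,1-t)&=\{(u,v):u+v=-2,\ u\le -2\},\\ T_6(t-1,-t)&=\{(u,v):v=u,\ u\le\min\{2t-2,-1\}\},\\ T_6(t,t-1)&=\{(u,v):u+v=-1,\ v\le -1\}, \end{aligned}$$ and $$T_6(0,\alpha)=\begin{cases}[-\alpha-1,-1]\times\{0\}&\text{if }0<\alpha<1,\\ [-1,-\alpha-1]\times\{-1\}&\text{if }-1<\alpha<0,\end{cases}\qquad T_6(x,y)=\begin{cases}\{(-1,0)\}&\text{if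 }0<x\le y<1-x,\\ \{(-1,-1)\}&\text{if }-1-x<y\le x<0,\end{cases}$$ and $T_6(x,y)=\emptyset$ for all other $(x,y)$. (2) The domain $\{z: T_6(z)\neq\emptyset\}$ of $T_6$ is the union of the diamond boundary $\{|x|+|y|=1\}$, the segment $\{0\}\times(-1,1)$, and the two closed triangles $\{0\le x\le y\le 1-x\}$ and $\{-1-x\le y\le x\le 0\}$. (3) $T_6$ is maximal 2-cyclically monotone. (4) $T_6$ is not maximal monotone, i.e. it is not a maximal element, with respect to inclusion of graphs, among the operators $T$ with $\langle x-y,x^*-y^*\rangle\ge 0$ for all $(x,x^*),(y,y^*)\in T$. -/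

import Mathlib

namespace CyclicMono

section General

variable {X : Type*} [NormedAddCommGroup X] [InnerProductSpace ℝ X]

/-- The domain of a multivalued operator on `X`.  Operators are identified with their graphs, so
an operator is a set of pairs `(x, x*)`, and the dual of the Hilbert space `X` is `X` itself. -/
def dom (T : Set (X × X)) : Set X := {x | ∃ xs, (x, xs) ∈ T}

/-- Monotone operators. -/
def IsMonotone (T : Set (X × X)) : Prop :=
  ∀ a ∈ T, ∀ b ∈ T, 0 ≤ inner ℝ (a.1 - b.1) (a.2 - b.2)

/-- The cyclic sum `∑ ⟨x_{i+1} - x_i, x_i*⟩` over `i = 0, …, p`, with `x_{p+1} = x_0`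
(the addition in `Fin (p + 1)` is cyclic). -/
noncomputable def cycleSum (p : ℕ) (z : Fin (p + 1) → X × X) : ℝ :=
  ∑ i, inner ℝ ((z (i + 1)).1 - (z i).1) (z i).2

/-- `p`-cyclically monotone operators. -/
def IsCyclicallyMonotone (p : ℕ) (T : Set (X × X)) : Prop :=
  ∀ z : Fin (p + 1) → X × X, (∀ i, z i ∈ T) → cycleSum p z ≤ 0

/-- Maximal `p`-cyclically monotone operators: the graph is not properly contained in the graph
of another `p`-cyclically monotone operator. -/
def IsMaximalCyclicallyMonotone (p : ℕ) (T : Set (X × X)) : Prop :=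
  Maximal (IsCyclicallyMonotone p) T

/-- The `p`-cyclically monotone polar of `T`: all `z_0` whose cyclic sums with any
`z_1, …, z_p` in `T` are nonpositive. -/
def polar (p : ℕ) (T : Set (X × X)) : Set (X × X) :=
  {w | ∀ z : Fin (p + 1) → X × X, z 0 = w → (∀ i, i ≠ 0 → z i ∈ T) → cycleSum p z ≤ 0}

/-- One step of the construction: add to `T` the whole image of `x` under the polar of `T`. -/
def polarStep (p : ℕ) (T : Set (X × X)) (x : X) : Set (X × X) :=
  {w | w.1 = x ∧ w ∈ polar p T} ∪ T

/-- The last step operator of the construction with starting points `L = [z_1, …, z_n]`: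
`T_0 = {z_1, …, z_n}`, `T_k` is obtained from `T_{k-1}` by a step at `x_k` for `k = 1, …, n`,
and `T_{n+1}` is the polar of `T_n`. -/
def lastStep (p : ℕ) (L : List (X × X)) : Set (X × X) :=
  polar p (L.foldl (fun T z => polarStep p T z.1) {z | z ∈ L})

end General

/-- The Euclidean plane. -/
abbrev Plane : Type := EuclideanSpace ℝ (Fin 2)

/-- The five starting points `(x_i, x_i*)`. -/
noncomputable def startPoints : List (Plane × Plane) :=
  [(!₂[0, 0], !₂[-1, -1 / 2]),
   (!₂[1, 0], !₂[0, 1]),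
   (!₂[0, 1], !₂[-1, 0]),
   (!₂[-1, 0], !₂[-2, -2]),
   (!₂[0, -1], !₂[0, -1])]

/-- The correspondence rule of the operator: `(u, v)` belongs to the image of `(x, y)`. -/
def Rule (x y u v : ℝ) : Prop :=
  -- the five starting points
  (x = 0 ∧ y = 0 ∧ u = -1 ∧ -1 ≤ v ∧ v ≤ 0) ∨
  (x = 1 ∧ y = 0 ∧ 0 ≤ u ∧ -1 - u ≤ v ∧ v ≤ 1 + u) ∨
  (x = 0 ∧ y = 1 ∧ 0 ≤ v ∧ -2 - v ≤ u ∧ u ≤ v - 1) ∨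
  (x = -1 ∧ y = 0 ∧ u ≤ -2 ∧ u ≤ v ∧ v ≤ -2 - u) ∨
  (x = 0 ∧ y = -1 ∧ v ≤ -1 ∧ v ≤ u ∧ u ≤ -1 - v) ∨
  -- the open sides of the diamond
  (∃ t : ℝ, 0 < t ∧ t < 1 ∧ x = 1 - t ∧ y = t ∧ v = 1 + u ∧ max (-2 * t) (-1) ≤ u) ∨
  (∃ t : ℝ, 0 < t ∧ t < 1 ∧ x = -t ∧ y = 1 - t ∧ u + v = -2 ∧ u ≤ -2) ∨
  (∃ t : ℝ, 0 < t ∧ t < 1 ∧ x = t - 1 ∧ y = -t ∧ v = u ∧ u ≤ min (2 * t - 2) (-1)) ∨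
  (∃ t : ℝ, 0 < t ∧ t < 1 ∧ x = t ∧ y = t - 1 ∧ u + v = -1 ∧ v ≤ -1) ∨
  -- the vertical segment without its end points and the origin
  (x = 0 ∧ 0 < y ∧ y < 1 ∧ -y - 1 ≤ u ∧ u ≤ -1 ∧ v = 0) ∨
  (x = 0 ∧ -1 < y ∧ y < 0 ∧ -1 ≤ u ∧ u ≤ -y - 1 ∧ v = -1) ∨
  -- the rest of the two triangles
  (0 < x ∧ x ≤ y ∧ y < 1 - x ∧ u = -1 ∧ v = 0) ∨
  (-1 - x < y ∧ y ≤ x ∧ x < 0 ∧ u = -1 ∧ v = -1)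

/-- The explicit operator `T₆` on the plane. -/
def T6 : Set (Plane × Plane) := {z | Rule (z.1 0) (z.1 1) (z.2 0) (z.2 1)}

end CyclicMono

/-!
A cyclic sum depends on each of its entries `(x, x*)` only through `⟪q - x, x*⟫ + ⟪x, a⟫`, where
`q` is the next position and `a` the preceding dual vector. Hence the inequalities of this form
that hold on a cyclically monotone set cut out a cyclically monotone hull, whatever set of positions
is allowed for `q`. Over the diamond `|x| + |y| ≤ 1` this hull admits segments between
points that are not strictly monotonically related, and normal vectors of the diamond; the twelve
points of `core` already generate `T6` in this way, so `T6` is 2-cyclically monotone because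
`core` is, a finite check.

Conversely, the first five steps of the construction produce the full images of `T6` at the
origin and at the corners. The rays in the images of `(1, 0)` and `(-1, 0)` confine the polar to
positions in the diamond, and there finitely many inequalities against vertices of these images
give the rule of `T6`. The point reflection `(x, y, u, v) ↦ (-x, -y, -2 - u, -1 - v)` preserves
`T6`, the diamond and the vertices, so it suffices to look at the upper half plane.

Finally, `((1/2, 0), (-1/2, -1/2))` is monotonically related to `core`. This is again an
inequality of the above form, so it extends to `T6`, whose domain does not contain `(1/2, 0)`.
-/

namespace CyclicMono

section General

open scoped InnerProductSpace

variable {X : Type*} [NormedAddCommGroup X] [InnerProductSpace ℝ X] {p : ℕ} {S T : Set (X × X)}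

theorem cycleSum_two (z : Fin 3 → X × X) :
    cycleSum 2 z = ⟪(z 1).1 - (z 0).1, (z 0).2⟫_ℝ + ⟪(z 2).1 - (z 1).1, (z 1).2⟫_ℝ +
      ⟪(z 0).1 - (z 2).1, (z 2).2⟫_ℝ :=
  Fin.sum_univ_three _

theorem polar_anti (h : T ⊆ S) : polar p S ⊆ polar p T :=
  fun _ hw z hz hT => hw z hz fun i hi => h (hT i hi)

theorem IsCyclicallyMonotone.subset_polar (hS : IsCyclicallyMonotone p S) (h : T ⊆ S) :
    S ⊆ polar p T := by
  rintro w hw z rfl hT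
  refine hS z fun i => ?_
  obtain rfl | hi := eq_or_ne i 0
  exacts [hw, h (hT i hi)]

theorem isCyclicallyMonotone_of_subset_polar (h : T ⊆ polar p T) : IsCyclicallyMonotone p T :=
  fun z hz => h (hz 0) z rfl fun i _ => hz i

theorem isMaximalCyclicallyMonotone_of_polar_eq (h : polar p T = T) :
    IsMaximalCyclicallyMonotone p T := by
  refine ⟨isCyclicallyMonotone_of_subset_polar h.ge, fun S hS hTS => ?_⟩
  calc S ⊆ polar p S := hS.subset_polar subset_rfl
    _ ⊆ polar p T := polar_anti hTS
    _ = T := h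

theorem exists_cycleSum_update_eq (z : Fin (p + 2) → X × X) (i : Fin (p + 2)) :
    ∃ C, ∀ w, cycleSum (p + 1) (Function.update z i w) =
      ⟪(z (i + 1)).1 - w.1, w.2⟫_ℝ + ⟪w.1, (z (i - 1)).2⟫_ℝ + C := by
  have hne : i - 1 ≠ i := by simp
  refine ⟨∑ j ∈ (Finset.univ.erase i).erase (i - 1), ⟪(z (j + 1)).1 - (z j).1, (z j).2⟫_ℝ
    - ⟪(z (i - 1)).1, (z (i - 1)).2⟫_ℝ, fun w => ?_⟩
  rw [cycleSum, ← Finset.add_sum_erase _ _ (Finset.mem_univ i),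
    ← Finset.add_sum_erase (Finset.univ.erase i) _
      (Finset.mem_erase.2 ⟨hne, Finset.mem_univ (i - 1)⟩)]
  have hrest : ∀ j ∈ (Finset.univ.erase i).erase (i - 1),
      ⟪(Function.update z i w (j + 1)).1 - (Function.update z i w j).1,
        (Function.update z i w j).2⟫_ℝ = ⟪(z (j + 1)).1 - (z j).1, (z j).2⟫_ℝ := by
    intro j hj
    simp only [Finset.mem_erase, Finset.mem_univ, and_true] at hj
    rw [Function.update_of_ne hj.2, Function.update_of_ne fun h => hj.1 (eq_sub_of_add_eq h)]
  rw [Finset.sum_congr rfl hrest]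
  simp only [Function.update_self, sub_add_cancel, Function.update_of_ne hne,
    Function.update_of_ne (show i + 1 ≠ i by simp), inner_sub_left]
  ring

theorem inner_sub_nonneg_of_mem_polar {w a : X × X} (hw : w ∈ polar (p + 1) T) (ha : a ∈ T) :
    0 ≤ ⟪w.1 - a.1, w.2 - a.2⟫_ℝ := by
  obtain ⟨C, hC⟩ := exists_cycleSum_update_eq (fun _ : Fin (p + 2) => a) 0
  have hconst : 0 = ⟪a.1, a.2⟫_ℝ + C := by simpa [cycleSum] using hC a
  have h := hw (Function.update (fun _ => a) 0 w) (Function.update_self ..) fun i hi => by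
    rwa [Function.update_of_ne hi]
  rw [hC] at h
  simp only [inner_sub_left, inner_sub_right] at h ⊢
  linarith

theorem IsCyclicallyMonotone.isMonotone (hT : IsCyclicallyMonotone (p + 1) T) : IsMonotone T :=
  fun _ ha _ hb => inner_sub_nonneg_of_mem_polar (hT.subset_polar subset_rfl ha) hb

theorem inner_nonpos_of_mem_polar_of_ray {w : X × X} {x xs n : X} (hw : w ∈ polar (p + 1) T)
    (hT : ∀ r : ℝ, 0 ≤ r → (x, xs + r • n) ∈ T) : ⟪w.1 - x, n⟫_ℝ ≤ 0 := by
  by_contra! hn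
  obtain ⟨r, hr⟩ := exists_nat_gt (⟪w.1 - x, w.2 - xs⟫_ℝ / ⟪w.1 - x, n⟫_ℝ)
  have h := inner_sub_nonneg_of_mem_polar hw (hT r r.cast_nonneg)
  rw [div_lt_iff₀ hn] at hr
  rw [← sub_sub, inner_sub_right _ (w.2 - xs), inner_smul_right] at h
  linarith

theorem polarStep_union_fibers (hS : IsCyclicallyMonotone p S) (hTS : T ⊆ S) {P : Set X} {x : X}
    (hx : ∀ xs, (x, xs) ∈ polar p (T ∪ {w ∈ S | w.1 ∈ P}) → (x, xs) ∈ S) :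
    polarStep p (T ∪ {w ∈ S | w.1 ∈ P}) x = T ∪ {w ∈ S | w.1 ∈ insert x P} := by
  have hpolar : S ⊆ polar p (T ∪ {w ∈ S | w.1 ∈ P}) :=
    hS.subset_polar (Set.union_subset hTS fun _ hw => hw.1)
  ext ⟨y, ys⟩
  constructor
  · rintro (⟨rfl, hw⟩ | hw | hw)
    exacts [.inr ⟨hx _ hw, .inl rfl⟩, .inl hw, .inr ⟨hw.1, .inr hw.2⟩]
  · rintro (hw | ⟨hw, rfl | hP⟩)
    exacts [.inr (.inl hw), .inl ⟨rfl, hpolar hw⟩, .inr (.inr ⟨hw, hP⟩)]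

theorem not_maximal_isMonotone_of_notMem (hT : IsMonotone T) {w : X × X} (hw : w ∉ T)
    (hwT : ∀ a ∈ T, 0 ≤ ⟪w.1 - a.1, w.2 - a.2⟫_ℝ) : ¬ Maximal IsMonotone T := by
  intro hmax
  refine hw (hmax.2 (y := insert w T) ?_ (Set.subset_insert w T) (Set.mem_insert w T))
  rintro a (rfl | ha) b (rfl | hb)
  · simp
  · exact hwT b hb
  · rw [← inner_neg_neg, neg_sub, neg_sub]
    exact hwT a ha
  · exact hT a ha b hb

/-- The point reflection `(x, x*) ↦ (-x, c - x*)` of the graph space. -/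
def reflect (c : X) (w : X × X) : X × X := (-w.1, c - w.2)

theorem cycleSum_reflect (c : X) (z : Fin (p + 1) → X × X) :
    cycleSum p (reflect c ∘ z) = cycleSum p z := by
  have htelescope : ∑ i, ((z (i + 1)).1 - (z i).1) = 0 := by
    rw [Finset.sum_sub_distrib, sub_eq_zero]
    exact Fintype.sum_equiv (Equiv.addRight 1) _ _ fun _ => rfl
  have hterm (i : Fin (p + 1)) : ⟪-(z (i + 1)).1 - -(z i).1, c - (z i).2⟫_ℝ =
      ⟪(z (i + 1)).1 - (z i).1, (z i).2⟫_ℝ - ⟪(z (i + 1)).1 - (z i).1, c⟫_ℝ := by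
    rw [← inner_sub_right, ← inner_neg_neg, neg_sub, neg_sub_neg, neg_sub]
  simp only [cycleSum, Function.comp_apply, reflect, hterm, Finset.sum_sub_distrib,
    ← sum_inner, htelescope, inner_zero_left, sub_zero]

theorem reflect_mem_polar {c : X} (hT : ∀ a ∈ T, reflect c a ∈ T) {w : X × X}
    (hw : w ∈ polar p T) : reflect c w ∈ polar p T := by
  intro z hz hzT
  rw [← cycleSum_reflect c]
  exact hw _ (by simp [reflect, hz])
    fun i hi => hT _ (hzT i hi)

/-- The hull of `K` over a set `D` of positions: the pairs over `D` that satisfy every inequality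
`⟪q - x, x*⟫ + ⟪x, a⟫ ≤ b` with `q ∈ D` valid on `K`.  A cyclic sum depends on each of its
entries `(x, x*)` through such an expression, where `q` is the next position and `a` the
preceding dual vector. -/
def cyclicHull (D : Set X) (K : Set (X × X)) : Set (X × X) :=
  {w | w.1 ∈ D ∧ ∀ q ∈ D, ∀ (a : X) (b : ℝ),
    (∀ k ∈ K, ⟪q - k.1, k.2⟫_ℝ + ⟪k.1, a⟫_ℝ ≤ b) → ⟪q - w.1, w.2⟫_ℝ + ⟪w.1, a⟫_ℝ ≤ b}

variable {D : Set X} {K : Set (X × X)}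

theorem subset_cyclicHull (hKD : ∀ k ∈ K, k.1 ∈ D) : K ⊆ cyclicHull D K :=
  fun k hk => ⟨hKD k hk, fun _ _ _ _ h => h k hk⟩

theorem segment_subset_cyclicHull (hD : Convex ℝ D) {w w' : X × X} (hw : w ∈ cyclicHull D K)
    (hw' : w' ∈ cyclicHull D K) (hww' : ⟪w.1 - w'.1, w.2 - w'.2⟫_ℝ ≤ 0) :
    segment ℝ w w' ⊆ cyclicHull D K := by
  rintro _ ⟨s, t, hs, ht, hst, rfl⟩
  refine ⟨hD hw.1 hw'.1 hs ht hst, fun q hq a b hK => ?_⟩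
  obtain rfl : s = 1 - t := by linarith
  have h := mul_le_mul_of_nonneg_left (hw.2 q hq a b hK) hs
  have h' := mul_le_mul_of_nonneg_left (hw'.2 q hq a b hK) ht
  have hcross := mul_nonneg (mul_nonneg hs ht) (neg_nonneg.2 hww')
  simp only [Prod.fst_add, Prod.snd_add, Prod.smul_fst, Prod.smul_snd, inner_sub_left,
    inner_sub_right, inner_add_left, inner_add_right, real_inner_smul_left,
    real_inner_smul_right] at h h' hcross ⊢
  linarith

theorem add_normal_mem_cyclicHull {x xs n : X} (hw : (x, xs) ∈ cyclicHull D K)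
    (hn : ∀ q ∈ D, ⟪q - x, n⟫_ℝ ≤ 0) : (x, xs + n) ∈ cyclicHull D K := by
  refine ⟨hw.1, fun q hq a b hK => ?_⟩
  rw [inner_add_right]
  linarith [hw.2 q hq a b hK, hn q hq]

theorem reflect_mem_cyclicHull {c : X} (hD : ∀ q ∈ D, -q ∈ D) (hK : ∀ k ∈ K, reflect c k ∈ K)
    {w : X × X} (hw : w ∈ cyclicHull D K) : reflect c w ∈ cyclicHull D K := by
  have hreflect (q a : X) (k : X × X) : ⟪q - (reflect c k).1, (reflect c k).2⟫_ℝ +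
      ⟪(reflect c k).1, a⟫_ℝ = ⟪-q - k.1, k.2⟫_ℝ + ⟪k.1, c - a⟫_ℝ + ⟪q, c⟫_ℝ := by
    simp only [reflect, inner_sub_left, inner_sub_right, inner_neg_left]
    ring
  refine ⟨hD _ hw.1, fun q hq a b h => ?_⟩
  rw [hreflect, ← le_sub_iff_add_le]
  refine hw.2 (-q) (hD q hq) (c - a) _ fun k hk => ?_
  rw [le_sub_iff_add_le, ← hreflect]
  exact h _ (hK k hk)

theorem inner_sub_nonneg_of_mem_cyclicHull {w z : X × X} (hwD : w.1 ∈ D)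
    (hwK : ∀ k ∈ K, 0 ≤ ⟪w.1 - k.1, w.2 - k.2⟫_ℝ) (hz : z ∈ cyclicHull D K) :
    0 ≤ ⟪w.1 - z.1, w.2 - z.2⟫_ℝ := by
  have hiff (k : X × X) : 0 ≤ ⟪w.1 - k.1, w.2 - k.2⟫_ℝ ↔
      ⟪w.1 - k.1, k.2⟫_ℝ + ⟪k.1, w.2⟫_ℝ ≤ ⟪w.1, w.2⟫_ℝ := by
    rw [inner_sub_right, inner_sub_left _ _ w.2, sub_sub, sub_nonneg, add_comm]
  simp only [hiff] at hwK ⊢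
  exact hz.2 w.1 hwD w.2 _ hwK

theorem IsCyclicallyMonotone.cyclicHull (hK : IsCyclicallyMonotone p K)
    (hKD : ∀ k ∈ K, k.1 ∈ D) : IsCyclicallyMonotone p (cyclicHull D K) := by
  obtain _ | p := p
  · intro z _
    simp [cycleSum]
  -- The entries are moved from `K` to its hull one at a time.
  suffices h : ∀ (s : Finset (Fin (p + 2))) (z : Fin (p + 2) → X × X),
      (∀ i, z i ∈ CyclicMono.cyclicHull D K) → (∀ i ∉ s, z i ∈ K) → cycleSum (p + 1) z ≤ 0 from
    fun z hz => h Finset.univ z hz fun i hi => absurd (Finset.mem_univ i) hi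
  intro s
  induction s using Finset.induction_on with
  | empty => exact fun z _ hz => hK z fun i => hz i (Finset.notMem_empty i)
  | insert i s _ ih =>
    intro z hz hzs
    obtain ⟨C, hC⟩ := exists_cycleSum_update_eq z i
    have h := (hz i).2 (z (i + 1)).1 (hz (i + 1)).1 (z (i - 1)).2 (-C) fun k hk => by
      have hk' := ih (Function.update z i k) (fun j => ?_) fun j hj => ?_
      · rw [hC] at hk'
        linarith
      · obtain rfl | hj := eq_or_ne j i
        · rw [Function.update_self]
          exact subset_cyclicHull hKD hk
        · rw [Function.update_of_ne hj]
          exact hz j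
      · obtain rfl | hji := eq_or_ne j i
        · rwa [Function.update_self]
        · rw [Function.update_of_ne hji]
          exact hzs j (by simp [hji, hj])
    rw [← Function.update_eq_self i z, hC]
    linarith

end General

section UpperRule

/-- The part of the correspondence rule of `T6` over the upper half of the diamond, described by
closed cells.  The rest of the rule is its image under `(x, y, u, v) ↦ (-x, -y, -2 - u, -1 - v)`. -/
inductive UpperRule (x y u v : ℝ) : Prop
  | center (hx : x = 0) (hy : y = 0) (hu : u = -1) (hv : -1 ≤ v) (hv' : v ≤ 0)
  | right (hx : x = 1) (hy : y = 0) (hu : 0 ≤ u) (hv : -1 - u ≤ v) (hv' : v ≤ 1 + u)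
  | top (hx : x = 0) (hy : y = 1) (hv : 0 ≤ v) (hu : -2 - v ≤ u) (hu' : u ≤ v - 1)
  | northEast (hx : x = 1 - y) (hy : 0 ≤ y) (hy' : y ≤ 1) (hv : v = 1 + u)
      (hu : -2 * y ≤ u) (hu' : -1 ≤ u)
  | northWest (hx : x = y - 1) (hy : 0 ≤ y) (hy' : y ≤ 1) (hv : v = -2 - u) (hu : u ≤ -2)
  | axis (hx : x = 0) (hy : 0 ≤ y) (hy' : y ≤ 1) (hu : -y - 1 ≤ u) (hu' : u ≤ -1) (hv : v = 0)
  | triangle (hx : 0 ≤ x) (hxy : x ≤ y) (hy : y ≤ 1 - x) (hu : u = -1) (hv : v = 0)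

variable {x y u v : ℝ}

theorem rule_iff_openCells : Rule x y u v ↔
    (x = 0 ∧ y = 0 ∧ u = -1 ∧ -1 ≤ v ∧ v ≤ 0) ∨
    (x = 1 ∧ y = 0 ∧ 0 ≤ u ∧ -1 - u ≤ v ∧ v ≤ 1 + u) ∨
    (x = 0 ∧ y = 1 ∧ 0 ≤ v ∧ -2 - v ≤ u ∧ u ≤ v - 1) ∨
    (x = -1 ∧ y = 0 ∧ u ≤ -2 ∧ u ≤ v ∧ v ≤ -2 - u) ∨
    (x = 0 ∧ y = -1 ∧ v ≤ -1 ∧ v ≤ u ∧ u ≤ -1 - v) ∨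
    (0 < y ∧ y < 1 ∧ x = 1 - y ∧ v = 1 + u ∧ -2 * y ≤ u ∧ -1 ≤ u) ∨
    (0 < y ∧ y < 1 ∧ x = y - 1 ∧ u + v = -2 ∧ u ≤ -2) ∨
    (-1 < y ∧ y < 0 ∧ x = -1 - y ∧ v = u ∧ u ≤ -2 * y - 2 ∧ u ≤ -1) ∨
    (-1 < y ∧ y < 0 ∧ x = 1 + y ∧ u + v = -1 ∧ v ≤ -1) ∨
    (x = 0 ∧ 0 < y ∧ y < 1 ∧ -y - 1 ≤ u ∧ u ≤ -1 ∧ v = 0) ∨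
    (x = 0 ∧ -1 < y ∧ y < 0 ∧ -1 ≤ u ∧ u ≤ -y - 1 ∧ v = -1) ∨
    (0 < x ∧ x ≤ y ∧ y < 1 - x ∧ u = -1 ∧ v = 0) ∨
    (-1 - x < y ∧ y ≤ x ∧ x < 0 ∧ u = -1 ∧ v = -1) := by
  have hNE : (∃ t : ℝ, 0 < t ∧ t < 1 ∧ x = 1 - t ∧ y = t ∧ v = 1 + u ∧ max (-2 * t) (-1) ≤ u) ↔
      0 < y ∧ y < 1 ∧ x = 1 - y ∧ v = 1 + u ∧ -2 * y ≤ u ∧ -1 ≤ u := by grind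
  have hNW : (∃ t : ℝ, 0 < t ∧ t < 1 ∧ x = -t ∧ y = 1 - t ∧ u + v = -2 ∧ u ≤ -2) ↔
      0 < y ∧ y < 1 ∧ x = y - 1 ∧ u + v = -2 ∧ u ≤ -2 :=
    ⟨by grind, fun h => ⟨1 - y, by grind⟩⟩
  have hSW : (∃ t : ℝ, 0 < t ∧ t < 1 ∧ x = t - 1 ∧ y = -t ∧ v = u ∧ u ≤ min (2 * t - 2) (-1)) ↔
      -1 < y ∧ y < 0 ∧ x = -1 - y ∧ v = u ∧ u ≤ -2 * y - 2 ∧ u ≤ -1 :=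
    ⟨by grind, fun h => ⟨-y, by grind⟩⟩
  have hSE : (∃ t : ℝ, 0 < t ∧ t < 1 ∧ x = t ∧ y = t - 1 ∧ u + v = -1 ∧ v ≤ -1) ↔
      -1 < y ∧ y < 0 ∧ x = 1 + y ∧ u + v = -1 ∧ v ≤ -1 :=
    ⟨by grind, fun h => ⟨1 + y, by grind⟩⟩
  rw [Rule, hNE, hNW, hSW, hSE]

theorem UpperRule.rule (h : UpperRule x y u v) : Rule x y u v := by
  rw [rule_iff_openCells]
  cases h <;> grind (splits := 40)

theorem UpperRule.rule_of_reflect (h : UpperRule (-x) (-y) (-2 - u) (-1 - v)) : Rule x y u v := by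
  rw [rule_iff_openCells]
  cases h <;> grind (splits := 40)

theorem rule_iff_upperRule :
    Rule x y u v ↔ UpperRule x y u v ∨ UpperRule (-x) (-y) (-2 - u) (-1 - v) := by
  refine ⟨fun h => ?_, fun h => h.elim UpperRule.rule UpperRule.rule_of_reflect⟩
  rw [rule_iff_openCells] at h
  grind (splits := 40) [UpperRule]

theorem rule_reflect_iff : Rule (-x) (-y) (-2 - u) (-1 - v) ↔ Rule x y u v := by
  rw [rule_iff_upperRule, rule_iff_upperRule, or_comm]
  simp only [neg_neg, sub_sub_cancel]

theorem exists_upperRule_iff :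
    (∃ u v, UpperRule x y u v) ↔ 0 ≤ y ∧ (|x| + y = 1 ∨ 0 ≤ x ∧ x ≤ y ∧ y ≤ 1 - x) := by
  constructor
  · rintro ⟨u, v, h⟩
    cases h <;> grind
  · rintro ⟨hy, h | ⟨hx, hxy, hy'⟩⟩
    · obtain hx | hx := abs_cases x
      · exact ⟨0, 1, .northEast (by linarith) hy (by linarith) (by norm_num) (by linarith)
          (by norm_num)⟩
      · exact ⟨-2, 0, .northWest (by linarith) hy (by linarith) (by norm_num) le_rfl⟩
    · exact ⟨-1, 0, .triangle hx hxy hy' rfl rfl⟩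

end UpperRule

section Plane

theorem inner_plane (a b : Plane) : inner ℝ a b = a 0 * b 0 + a 1 * b 1 := by
  simp [PiLp.inner_apply, Fin.sum_univ_two, mul_comm]

/-- The point of the graph space with position `(x, y)` and dual vector `(u, v)`. -/
noncomputable def pt (x y u v : ℝ) : Plane × Plane := (!₂[x, y], !₂[u, v])

theorem pt_eta (w : Plane × Plane) : pt (w.1 0) (w.1 1) (w.2 0) (w.2 1) = w := by
  ext i <;> fin_cases i <;> rfl

theorem reflect_pt (x y u v : ℝ) :
    reflect !₂[-2, -1] (pt x y u v) = pt (-x) (-y) (-2 - u) (-1 - v) := by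
  ext i <;> fin_cases i <;> simp [reflect, pt]

theorem pt_mem_polar_two {T : Set (Plane × Plane)} {x y u v x₁ y₁ u₁ v₁ x₂ y₂ u₂ v₂ : ℝ}
    (h : pt x y u v ∈ polar 2 T) (h₁ : pt x₁ y₁ u₁ v₁ ∈ T) (h₂ : pt x₂ y₂ u₂ v₂ ∈ T) :
    (x₁ - x) * u + (y₁ - y) * v + ((x₂ - x₁) * u₁ + (y₂ - y₁) * v₁) +
      ((x - x₂) * u₂ + (y - y₂) * v₂) ≤ 0 := by
  have hsum := h ![pt x y u v, pt x₁ y₁ u₁ v₁, pt x₂ y₂ u₂ v₂] rfl fun i hi => by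
    fin_cases i <;> simp_all
  simpa [cycleSum_two, inner_plane, pt] using hsum

/-- The square of positions `|x| + |y| ≤ 1`, the convex hull of the domain of `T6`. -/
def diamond : Set Plane := {z | |z 0| + |z 1| ≤ 1}

theorem mem_diamond_iff {z : Plane} :
    z ∈ diamond ↔ z 0 + z 1 ≤ 1 ∧ z 0 - z 1 ≤ 1 ∧ -z 0 + z 1 ≤ 1 ∧ -z 0 - z 1 ≤ 1 := by
  simp only [diamond, Set.mem_ofPred_eq]
  grind

theorem convex_diamond : Convex ℝ diamond := by
  intro a ha b hb s t hs ht hst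
  simp only [mem_diamond_iff, PiLp.add_apply, PiLp.smul_apply, smul_eq_mul] at *
  obtain rfl : s = 1 - t := by linarith
  refine ⟨?_, ?_, ?_, ?_⟩ <;> nlinarith

theorem neg_mem_diamond {z : Plane} (hz : z ∈ diamond) : -z ∈ diamond := by
  simpa [diamond] using hz

/-- The vertices of the fibers of `T6` over the origin and the corners of the diamond. -/
def vertices : Set (Plane × Plane) :=
  {pt 0 0 (-1) (-1), pt 0 0 (-1) 0, pt 1 0 0 1, pt 1 0 0 (-1), pt 0 1 (-1) 0, pt 0 1 (-2) 0,
    pt (-1) 0 (-2) (-2), pt (-1) 0 (-2) 0, pt 0 (-1) 0 (-1), pt 0 (-1) (-1) (-1)}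

/-- The finite set whose cyclic hull over the diamond contains `T6`: the vertices together with
the points at which the image `{-1} × {0}` of the upper triangle, and its reflection, reach the
boundary of the diamond. -/
def core : Set (Plane × Plane) :=
  vertices ∪ {pt (1 / 2) (1 / 2) (-1) 0, pt (-1 / 2) (-1 / 2) (-1) (-1)}

theorem reflect_mem_vertices {k : Plane × Plane} (hk : k ∈ vertices) :
    reflect !₂[-2, -1] k ∈ vertices := by
  simp only [vertices, Set.mem_insert_iff, Set.mem_singleton_iff] at hk ⊢
  rcases hk with rfl | rfl | rfl | rfl | rfl | rfl | rfl | rfl | rfl | rfl <;>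
    norm_num [reflect_pt]

theorem reflect_mem_core {k : Plane × Plane} (hk : k ∈ core) : reflect !₂[-2, -1] k ∈ core := by
  obtain hk | rfl | rfl := hk
  · exact .inl (reflect_mem_vertices hk)
  · norm_num [core, reflect_pt]
  · norm_num [core, reflect_pt]

/-- The points of `core`, with positions doubled so that all coordinates are integers. -/
def coreCoordinates : List (ℤ × ℤ × ℤ × ℤ) :=
  [(0, 0, -1, -1), (0, 0, -1, 0), (2, 0, 0, 1), (2, 0, 0, -1), (0, 2, -1, 0), (0, 2, -2, 0),
    (-2, 0, -2, -2), (-2, 0, -2, 0), (0, -2, 0, -1), (0, -2, -1, -1), (1, 1, -1, 0),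
    (-1, -1, -1, -1)]

theorem exists_coreCoordinates {k : Plane × Plane} (hk : k ∈ core) :
    ∃ c ∈ coreCoordinates, k = pt (c.1 / 2) (c.2.1 / 2) c.2.2.1 c.2.2.2 := by
  simp only [core, vertices, Set.union_insert, Set.union_singleton, Set.mem_insert_iff,
    Set.mem_singleton_iff] at hk
  rcases hk with rfl | rfl | rfl | rfl | rfl | rfl | rfl | rfl | rfl | rfl | rfl | rfl <;>
    norm_num [coreCoordinates]

set_option maxRecDepth 20000 in
theorem coreCoordinates_cyclic : ∀ a ∈ coreCoordinates, ∀ b ∈ coreCoordinates,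
    ∀ c ∈ coreCoordinates,
      (b.1 - a.1) * a.2.2.1 + (b.2.1 - a.2.1) * a.2.2.2 +
      ((c.1 - b.1) * b.2.2.1 + (c.2.1 - b.2.1) * b.2.2.2) +
      ((a.1 - c.1) * c.2.2.1 + (a.2.1 - c.2.1) * c.2.2.2) ≤ 0 := by
  decide

theorem isCyclicallyMonotone_core : IsCyclicallyMonotone 2 core := by
  intro z hz
  obtain ⟨a, ha, hza⟩ := exists_coreCoordinates (hz 0)
  obtain ⟨b, hb, hzb⟩ := exists_coreCoordinates (hz 1)
  obtain ⟨c, hc, hzc⟩ := exists_coreCoordinates (hz 2)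
  have h := coreCoordinates_cyclic a ha b hb c hc
  rify at h
  simp only [cycleSum_two, inner_plane, hza, hzb, hzc, pt, PiLp.sub_apply, Matrix.cons_val_zero,
    Matrix.cons_val_one]
  linarith

theorem fst_mem_diamond_of_mem_core {k : Plane × Plane} (hk : k ∈ core) : k.1 ∈ diamond := by
  obtain ⟨c, hc, rfl⟩ := exists_coreCoordinates hk
  have h : |c.1| + |c.2.1| ≤ 2 := by
    clear hk
    revert c
    decide
  rify at h
  simp only [diamond, pt, Set.mem_ofPred_eq, Matrix.cons_val_zero, Matrix.cons_val_one,
    abs_div, Nat.abs_ofNat]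
  linarith

end Plane

section Inclusion

variable {x y u v : ℝ}

theorem exists_eq_convexComb_of_le_of_le {a b c : ℝ} (h : a ≤ c) (h' : c ≤ b) :
    ∃ t, 0 ≤ t ∧ t ≤ 1 ∧ c = (1 - t) * a + t * b := by
  obtain ⟨s, t, hs, ht, hst, rfl⟩ := (segment_eq_Icc (h.trans h')).ge ⟨h, h'⟩
  exact ⟨t, ht, by linarith, by simp [← hst]⟩

theorem pt_mem_cyclicHull_of_segment {K : Set (Plane × Plane)}
    {t x₁ y₁ u₁ v₁ x₂ y₂ u₂ v₂ : ℝ} (ht : 0 ≤ t) (ht' : t ≤ 1)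
    (h₁ : pt x₁ y₁ u₁ v₁ ∈ cyclicHull diamond K) (h₂ : pt x₂ y₂ u₂ v₂ ∈ cyclicHull diamond K)
    (h : (x₁ - x₂) * (u₁ - u₂) + (y₁ - y₂) * (v₁ - v₂) ≤ 0)
    (hx : x = (1 - t) * x₁ + t * x₂ := by ring) (hy : y = (1 - t) * y₁ + t * y₂ := by ring)
    (hu : u = (1 - t) * u₁ + t * u₂ := by ring) (hv : v = (1 - t) * v₁ + t * v₂ := by ring) :
    pt x y u v ∈ cyclicHull diamond K := by
  refine segment_subset_cyclicHull convex_diamond h₁ h₂ (by simpa [inner_plane, pt] using h)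
    ⟨1 - t, t, sub_nonneg.2 ht', ht, sub_add_cancel 1 t, ?_⟩
  subst hx hy hu hv
  ext i <;> fin_cases i <;> simp [pt]

theorem pt_add_normal_mem_cyclicHull {K : Set (Plane × Plane)} {a b : ℝ}
    (h : pt x y u v ∈ cyclicHull diamond K)
    (hn : ∀ q ∈ diamond, (q 0 - x) * a + (q 1 - y) * b ≤ 0) :
    pt x y (u + a) (v + b) ∈ cyclicHull diamond K := by
  have h' := add_normal_mem_cyclicHull (n := !₂[a, b]) h (by simpa [inner_plane] using hn)
  convert h' using 1
  ext i <;> fin_cases i <;> simp [pt]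

theorem core_subset_cyclicHull : core ⊆ cyclicHull diamond core :=
  subset_cyclicHull fun _ => fst_mem_diamond_of_mem_core

theorem reflect_mem_cyclicHull_core {w : Plane × Plane} (hw : w ∈ cyclicHull diamond core) :
    reflect !₂[-2, -1] w ∈ cyclicHull diamond core :=
  reflect_mem_cyclicHull (fun _ => neg_mem_diamond) (fun _ => reflect_mem_core) hw

theorem northEast_mem_cyclicHull (hy : 0 ≤ y) (hy' : y ≤ 1) (hu : -2 * y ≤ u) (hu' : -1 ≤ u) :
    pt (1 - y) y u (1 + u) ∈ cyclicHull diamond core := by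
  have hmid : pt (1 / 2) (1 / 2) (-1) 0 ∈ cyclicHull diamond core :=
    core_subset_cyclicHull (by simp [core])
  obtain ⟨s, hs, hbase⟩ : ∃ s ≤ u, pt (1 - y) y s (1 + s) ∈ cyclicHull diamond core := by
    obtain h | h := le_total y (1 / 2)
    · exact ⟨-2 * y, hu, pt_mem_cyclicHull_of_segment (t := 2 * y) (by linarith) (by linarith)
        (core_subset_cyclicHull (show pt 1 0 0 1 ∈ core by simp [core, vertices])) hmid
        (by norm_num)⟩
    · exact ⟨-1, hu', pt_mem_cyclicHull_of_segment (t := 2 * y - 1) (by linarith) (by linarith)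
        hmid (core_subset_cyclicHull (show pt 0 1 (-1) 0 ∈ core by simp [core, vertices]))
        (by norm_num)⟩
  have h := pt_add_normal_mem_cyclicHull (a := u - s) (b := u - s) hbase fun q hq => by
    rw [mem_diamond_iff] at hq
    nlinarith
  convert h using 2 <;> ring

theorem northWest_mem_cyclicHull (hy : 0 ≤ y) (hy' : y ≤ 1) (hu : u ≤ -2) :
    pt (y - 1) y u (-2 - u) ∈ cyclicHull diamond core := by
  have hbase : pt (y - 1) y (-2) 0 ∈ cyclicHull diamond core :=
    pt_mem_cyclicHull_of_segment hy hy'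
      (core_subset_cyclicHull (show pt (-1) 0 (-2) 0 ∈ core by simp [core, vertices]))
      (core_subset_cyclicHull (show pt 0 1 (-2) 0 ∈ core by simp [core, vertices])) (by norm_num)
  have h := pt_add_normal_mem_cyclicHull (a := u + 2) (b := -2 - u) hbase fun q hq => by
    rw [mem_diamond_iff] at hq
    nlinarith
  convert h using 2 <;> ring

theorem triangle_mem_cyclicHull (hx : 0 ≤ x) (hxy : x ≤ y) (hy : y ≤ 1 - x) :
    pt x y (-1) 0 ∈ cyclicHull diamond core := by
  have hdiagonal : pt x x (-1) 0 ∈ cyclicHull diamond core :=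
    pt_mem_cyclicHull_of_segment (t := 2 * x) (by linarith) (by linarith)
      (core_subset_cyclicHull (show pt 0 0 (-1) 0 ∈ core by simp [core, vertices]))
      (core_subset_cyclicHull (show pt (1 / 2) (1 / 2) (-1) 0 ∈ core by simp [core]))
      (by norm_num)
  have hside : pt x (1 - x) (-1) 0 ∈ cyclicHull diamond core := by
    simpa using northEast_mem_cyclicHull (y := 1 - x) (u := -1) (by linarith) (by linarith)
      (by linarith) le_rfl
  obtain ⟨t, ht, ht', rfl⟩ := exists_eq_convexComb_of_le_of_le hxy hy
  exact pt_mem_cyclicHull_of_segment ht ht' hdiagonal hside (by simp)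

theorem right_mem_cyclicHull (hu : 0 ≤ u) (hv : -1 - u ≤ v) (hv' : v ≤ 1 + u) :
    pt 1 0 u v ∈ cyclicHull diamond core := by
  have hupper : pt 1 0 u (1 + u) ∈ cyclicHull diamond core := by
    simpa using northEast_mem_cyclicHull le_rfl zero_le_one (by simpa using hu) (by linarith)
  have hlower : pt 1 0 u (-1 - u) ∈ cyclicHull diamond core := by
    simpa [reflect_pt] using reflect_mem_cyclicHull_core
      (northWest_mem_cyclicHull le_rfl zero_le_one (sub_le_self (-2) hu))
  obtain ⟨t, ht, ht', rfl⟩ := exists_eq_convexComb_of_le_of_le hv hv'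
  exact pt_mem_cyclicHull_of_segment ht ht' hlower hupper (by simp)

theorem top_mem_cyclicHull (hv : 0 ≤ v) (hu : -2 - v ≤ u) (hu' : u ≤ v - 1) :
    pt 0 1 u v ∈ cyclicHull diamond core := by
  have hleft : pt 0 1 (-2 - v) v ∈ cyclicHull diamond core := by
    simpa using northWest_mem_cyclicHull zero_le_one le_rfl (sub_le_self (-2) hv)
  have hright : pt 0 1 (v - 1) v ∈ cyclicHull diamond core := by
    simpa using northEast_mem_cyclicHull (u := v - 1) zero_le_one le_rfl (by linarith)
      (by linarith)
  obtain ⟨t, ht, ht', rfl⟩ := exists_eq_convexComb_of_le_of_le hu hu'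
  exact pt_mem_cyclicHull_of_segment ht ht' hleft hright (by simp)

theorem axis_mem_cyclicHull (hy : 0 ≤ y) (hy' : y ≤ 1) (hu : -y - 1 ≤ u) (hu' : u ≤ -1) :
    pt 0 y u 0 ∈ cyclicHull diamond core := by
  have hleft : pt 0 y (-y - 1) 0 ∈ cyclicHull diamond core :=
    pt_mem_cyclicHull_of_segment hy hy'
      (core_subset_cyclicHull (show pt 0 0 (-1) 0 ∈ core by simp [core, vertices]))
      (core_subset_cyclicHull (show pt 0 1 (-2) 0 ∈ core by simp [core, vertices])) (by simp)
  have hright := triangle_mem_cyclicHull le_rfl hy (by simpa using hy')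
  obtain ⟨t, ht, ht', rfl⟩ := exists_eq_convexComb_of_le_of_le hu hu'
  exact pt_mem_cyclicHull_of_segment ht ht' hleft hright (by simp)

theorem center_mem_cyclicHull (hv : -1 ≤ v) (hv' : v ≤ 0) :
    pt 0 0 (-1) v ∈ cyclicHull diamond core := by
  obtain ⟨t, ht, ht', rfl⟩ := exists_eq_convexComb_of_le_of_le hv hv'
  exact pt_mem_cyclicHull_of_segment ht ht'
    (core_subset_cyclicHull (show pt 0 0 (-1) (-1) ∈ core by simp [core, vertices]))
    (core_subset_cyclicHull (show pt 0 0 (-1) 0 ∈ core by simp [core, vertices])) (by simp)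

theorem UpperRule.mem_cyclicHull (h : UpperRule x y u v) :
    pt x y u v ∈ cyclicHull diamond core := by
  cases h with
  | center hx hy hu hv hv' => subst hx hy hu; exact center_mem_cyclicHull hv hv'
  | right hx hy hu hv hv' => subst hx hy; exact right_mem_cyclicHull hu hv hv'
  | top hx hy hv hu hu' => subst hx hy; exact top_mem_cyclicHull hv hu hu'
  | northEast hx hy hy' hv hu hu' => subst hx hv; exact northEast_mem_cyclicHull hy hy' hu hu'
  | northWest hx hy hy' hv hu => subst hx hv; exact northWest_mem_cyclicHull hy hy' hu
  | axis hx hy hy' hu hu' hv => subst hx hv; exact axis_mem_cyclicHull hy hy' hu hu'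
  | triangle hx hxy hy hu hv => subst hu hv; exact triangle_mem_cyclicHull hx hxy hy

theorem T6_subset_cyclicHull : T6 ⊆ cyclicHull diamond core := by
  intro w hw
  obtain h | h := rule_iff_upperRule.1 hw
  · simpa only [pt_eta] using h.mem_cyclicHull
  · simpa only [reflect_pt, neg_neg, sub_sub_cancel, pt_eta] using
      reflect_mem_cyclicHull_core h.mem_cyclicHull

theorem isCyclicallyMonotone_T6 : IsCyclicallyMonotone 2 T6 := fun z hz =>
  isCyclicallyMonotone_core.cyclicHull (fun _ => fst_mem_diamond_of_mem_core) z
    fun i => T6_subset_cyclicHull (hz i)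

end Inclusion

section Fibers

variable {T : Set (Plane × Plane)} {u v : ℝ}

theorem rule_center (hu : u = -1) (hv : -1 ≤ v) (hv' : v ≤ 0) : Rule 0 0 u v :=
  .inl ⟨rfl, rfl, hu, hv, hv'⟩

theorem rule_right (hu : 0 ≤ u) (hv : -1 - u ≤ v) (hv' : v ≤ 1 + u) : Rule 1 0 u v :=
  .inr (.inl ⟨rfl, rfl, hu, hv, hv'⟩)

theorem rule_top (hv : 0 ≤ v) (hu : -2 - v ≤ u) (hu' : u ≤ v - 1) : Rule 0 1 u v :=
  .inr (.inr (.inl ⟨rfl, rfl, hv, hu, hu'⟩))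

theorem rule_left (hu : u ≤ -2) (hv : u ≤ v) (hv' : v ≤ -2 - u) : Rule (-1) 0 u v :=
  .inr (.inr (.inr (.inl ⟨rfl, rfl, hu, hv, hv'⟩)))

theorem rule_bottom (hv : v ≤ -1) (hu : v ≤ u) (hu' : u ≤ -1 - v) : Rule 0 (-1) u v :=
  .inr (.inr (.inr (.inr (.inl ⟨rfl, rfl, hv, hu, hu'⟩))))

theorem rule_center_of_mem_polar (h : pt 0 0 u v ∈ polar 2 T) (hR : pt 1 0 0 1 ∈ T)
    (hU : pt 0 1 (-1) 0 ∈ T) (hL : pt (-1) 0 (-2) (-2) ∈ T) (hD : pt 0 (-1) 0 (-1) ∈ T) :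
    Rule 0 0 u v := by
  have h₁ := pt_mem_polar_two h hR hU
  have h₂ := pt_mem_polar_two h hL hD
  have h₃ := pt_mem_polar_two h hD hD
  have h₄ := pt_mem_polar_two h hU hU
  apply rule_center <;> linarith

theorem rule_right_of_mem_polar (h : pt 1 0 u v ∈ polar 2 T) (hO : pt 0 0 (-1) (-1) ∈ T)
    (hU : pt 0 1 (-1) 0 ∈ T) (hD : pt 0 (-1) 0 (-1) ∈ T) :
    Rule 1 0 u v := by
  have h₁ := pt_mem_polar_two h hO hD
  have h₂ := pt_mem_polar_two h hD hD
  have h₃ := pt_mem_polar_two h hU hU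
  apply rule_right <;> linarith

theorem rule_top_of_mem_polar (h : pt 0 1 u v ∈ polar 2 T) (hO : pt 0 0 (-1) 0 ∈ T)
    (hR : pt 1 0 0 1 ∈ T) (hU : pt 0 1 (-1) 0 ∈ T) (hL : pt (-1) 0 (-2) (-2) ∈ T)
    (hD : pt 0 (-1) 0 (-1) ∈ T) : Rule 0 1 u v := by
  have h₁ := pt_mem_polar_two h hO hU
  have h₂ := pt_mem_polar_two h hL hD
  have h₃ := pt_mem_polar_two h hR hU
  apply rule_top <;> linarith

theorem rule_left_of_mem_polar (h : pt (-1) 0 u v ∈ polar 2 T) (hO : pt 0 0 (-1) (-1) ∈ T)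
    (hO' : pt 0 0 (-1) 0 ∈ T) (hU : pt 0 1 (-2) 0 ∈ T) (hD : pt 0 (-1) 0 (-1) ∈ T) :
    Rule (-1) 0 u v := by
  have h₁ := pt_mem_polar_two h hO' hU
  have h₂ := pt_mem_polar_two h hD hO
  have h₃ := pt_mem_polar_two h hU hU
  apply rule_left <;> linarith

theorem rule_bottom_of_mem_polar (h : pt 0 (-1) u v ∈ polar 2 T) (hO : pt 0 0 (-1) (-1) ∈ T)
    (hR : pt 1 0 0 (-1) ∈ T) (hL : pt (-1) 0 (-2) (-2) ∈ T) :
    Rule 0 (-1) u v := by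
  have h₁ := pt_mem_polar_two h hO hO
  have h₂ := pt_mem_polar_two h hL hL
  have h₃ := pt_mem_polar_two h hR hR
  apply rule_bottom <;> linarith

end Fibers

section Regions

variable {x y u v : ℝ}

theorem triangle_inequalities_of_mem_polar (h : pt x y u v ∈ polar 2 vertices) :
    -x ≤ x * u + y * v ∧ -y ≤ x * u + y * v ∧ u + 1 - x ≤ x * u + y * v ∧
      v - x ≤ x * u + y * v := by
  refine ⟨?_, ?_, ?_, ?_⟩
  · linarith [pt_mem_polar_two h (show pt 0 0 (-1) 0 ∈ vertices by simp [vertices])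
      (show pt 0 0 (-1) 0 ∈ vertices by simp [vertices])]
  · linarith [pt_mem_polar_two h (show pt 0 0 (-1) (-1) ∈ vertices by simp [vertices])
      (show pt 0 (-1) 0 (-1) ∈ vertices by simp [vertices])]
  · linarith [pt_mem_polar_two h (show pt 1 0 0 1 ∈ vertices by simp [vertices])
      (show pt 0 1 (-1) 0 ∈ vertices by simp [vertices])]
  · linarith [pt_mem_polar_two h (show pt 0 1 (-1) 0 ∈ vertices by simp [vertices])
      (show pt 0 1 (-1) 0 ∈ vertices by simp [vertices])]

theorem northWest_inequalities_of_mem_polar (h : pt x y u v ∈ polar 2 vertices) :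
    -2 * x ≤ x * u + y * v ∧ v - 2 * x ≤ x * u + y * v ∧ -u - 1 - x - y ≤ x * u + y * v := by
  refine ⟨?_, ?_, ?_⟩
  · linarith [pt_mem_polar_two h (show pt 0 0 (-1) 0 ∈ vertices by simp [vertices])
      (show pt 0 1 (-2) 0 ∈ vertices by simp [vertices])]
  · linarith [pt_mem_polar_two h (show pt 0 1 (-2) 0 ∈ vertices by simp [vertices])
      (show pt 0 1 (-2) 0 ∈ vertices by simp [vertices])]
  · linarith [pt_mem_polar_two h (show pt (-1) 0 (-2) (-2) ∈ vertices by simp [vertices])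
      (show pt 0 (-1) (-1) (-1) ∈ vertices by simp [vertices])]

theorem northEast_of_mem_polar (hy : 0 < y) (hy' : y < 1)
    (h : pt (1 - y) y u v ∈ polar 2 vertices) : v = 1 + u ∧ -2 * y ≤ u ∧ -1 ≤ u := by
  obtain ⟨h₁, h₂, h₃, h₄⟩ := triangle_inequalities_of_mem_polar h
  have hv : 1 + u ≤ v := by nlinarith
  have hv' : v ≤ 1 + u := by nlinarith
  obtain rfl : v = 1 + u := le_antisymm hv' hv
  exact ⟨rfl, by linarith, by linarith⟩

theorem triangle_of_mem_polar (hx : 0 < x) (hy : 0 ≤ y) (hxy : x + y < 1)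
    (h : pt x y u v ∈ polar 2 vertices) : x ≤ y ∧ u = -1 ∧ v = 0 := by
  obtain ⟨h₁, h₂, h₃, h₄⟩ := triangle_inequalities_of_mem_polar h
  have hpairing : x * u + y * v = -x := by
    have hcomb : (1 - x - y) * (x * u + y * v) ≤ (1 - x - y) * -x := by
      linear_combination x * h₃ + y * h₄
    linarith [le_of_mul_le_mul_left hcomb (by linarith)]
  exact ⟨by linarith, by nlinarith, by nlinarith⟩

theorem axis_of_mem_polar (hy : 0 < y) (hy' : y < 1) (h : pt 0 y u v ∈ polar 2 vertices) :
    -y - 1 ≤ u ∧ u ≤ -1 ∧ v = 0 := by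
  obtain ⟨h₁, -, h₃, h₄⟩ := triangle_inequalities_of_mem_polar h
  have hleft := pt_mem_polar_two h (show pt (-1) 0 (-2) (-2) ∈ vertices by simp [vertices])
    (show pt 0 (-1) 0 (-1) ∈ vertices by simp [vertices])
  obtain rfl : v = 0 := by nlinarith
  exact ⟨by linarith, by linarith, rfl⟩

theorem eq_one_add_of_mem_polar (hx : x < 0) (hy : 0 ≤ y) (hxy : y ≤ 1 + x)
    (h : pt x y u v ∈ polar 2 vertices) : y = 1 + x := by
  obtain ⟨h₁, h₂, h₃⟩ := northWest_inequalities_of_mem_polar h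
  have hcomb : 0 ≤ x * (1 + x - y) := by
    linear_combination mul_le_mul_of_nonneg_left h₁ (sub_nonneg.2 hxy) + y * h₂ +
      mul_le_mul_of_nonneg_left h₃ (neg_nonneg.2 hx.le)
  linarith [nonpos_of_mul_nonneg_right hcomb hx]

theorem northWest_of_mem_polar (hy : 0 < y) (hy' : y < 1)
    (h : pt (y - 1) y u v ∈ polar 2 vertices) : v = -2 - u ∧ u ≤ -2 := by
  obtain ⟨h₁, h₂, h₃⟩ := northWest_inequalities_of_mem_polar h
  have hv : v ≤ -2 - u := by nlinarith
  have hv' : -2 - u ≤ v := by nlinarith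
  obtain rfl : v = -2 - u := le_antisymm hv hv'
  exact ⟨rfl, by linarith⟩

theorem rule_of_mem_polar_of_neg (hx : x < 0) (hy : 0 ≤ y) (hxy : y ≤ 1 + x)
    (h : pt x y u v ∈ polar 2 vertices) : Rule x y u v := by
  obtain rfl : x = y - 1 := by linarith [eq_one_add_of_mem_polar hx hy hxy h]
  obtain rfl | hy := hy.eq_or_lt
  · rw [zero_sub] at h ⊢
    exact rule_left_of_mem_polar h (by simp [vertices]) (by simp [vertices])
      (by simp [vertices]) (by simp [vertices])
  · have hside := northWest_of_mem_polar hy (by linarith) h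
    exact UpperRule.rule (.northWest rfl hy.le (by linarith) hside.1 hside.2)

theorem rule_of_mem_polar_axis (hy : 0 ≤ y) (hy' : y ≤ 1)
    (h : pt 0 y u v ∈ polar 2 vertices) : Rule 0 y u v := by
  obtain rfl | hy := hy.eq_or_lt
  · exact rule_center_of_mem_polar h (by simp [vertices]) (by simp [vertices])
      (by simp [vertices]) (by simp [vertices])
  obtain rfl | hy' := hy'.eq_or_lt
  · exact rule_top_of_mem_polar h (by simp [vertices]) (by simp [vertices])
      (by simp [vertices]) (by simp [vertices]) (by simp [vertices])
  · have haxis := axis_of_mem_polar hy hy' h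
    exact UpperRule.rule (.axis rfl hy.le hy'.le haxis.1 haxis.2.1 haxis.2.2)

theorem rule_of_mem_polar_of_pos (hx : 0 < x) (hy : 0 ≤ y) (hxy : x + y ≤ 1)
    (h : pt x y u v ∈ polar 2 vertices) : Rule x y u v := by
  obtain hlt | heq := hxy.lt_or_eq
  · have htriangle := triangle_of_mem_polar hx hy hlt h
    exact UpperRule.rule
      (.triangle hx.le htriangle.1 (by linarith) htriangle.2.1 htriangle.2.2)
  obtain rfl : x = 1 - y := by linarith
  obtain rfl | hy := hy.eq_or_lt
  · rw [sub_zero] at h ⊢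
    exact rule_right_of_mem_polar h (by simp [vertices]) (by simp [vertices])
      (by simp [vertices])
  · have hside := northEast_of_mem_polar hy (by linarith) h
    exact UpperRule.rule (.northEast rfl hy.le (by linarith) hside.1 hside.2.1 hside.2.2)

theorem rule_of_mem_polar_of_nonneg (hy : 0 ≤ y) (hxy : x + y ≤ 1) (hxy' : y ≤ 1 + x)
    (h : pt x y u v ∈ polar 2 vertices) : Rule x y u v := by
  obtain hx | rfl | hx := lt_trichotomy x 0
  exacts [rule_of_mem_polar_of_neg hx hy hxy' h,
    rule_of_mem_polar_axis hy (by linarith) h, rule_of_mem_polar_of_pos hx hy hxy h]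

theorem mem_T6_of_mem_polar_vertices {w : Plane × Plane} (hw : w ∈ polar 2 vertices)
    (hwD : w.1 ∈ diamond) : w ∈ T6 := by
  obtain ⟨h₁, h₂, h₃, h₄⟩ := mem_diamond_iff.1 hwD
  obtain hy | hy := le_total 0 (w.1 1)
  · rw [← pt_eta w] at hw
    exact rule_of_mem_polar_of_nonneg hy h₁ (by linarith) hw
  · have hw' := reflect_mem_polar (c := !₂[-2, -1]) (fun _ => reflect_mem_vertices) hw
    rw [← pt_eta w, reflect_pt] at hw'
    exact rule_reflect_iff.1
      (rule_of_mem_polar_of_nonneg (by linarith) (by linarith) (by linarith) hw')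

theorem fst_mem_diamond_of_mem_polar {T : Set (Plane × Plane)} {w : Plane × Plane}
    (hw : w ∈ polar 2 T) (hR : ∀ u v, 0 ≤ u → -1 - u ≤ v → v ≤ 1 + u → pt 1 0 u v ∈ T)
    (hL : ∀ u v, u ≤ -2 → u ≤ v → v ≤ -2 - u → pt (-1) 0 u v ∈ T) : w.1 ∈ diamond := by
  have hray {x y u v a b : ℝ} (h : ∀ r, 0 ≤ r → pt x y (u + r * a) (v + r * b) ∈ T) :
      (w.1 0 - x) * a + (w.1 1 - y) * b ≤ 0 := by
    have hn := inner_nonpos_of_mem_polar_of_ray (x := !₂[x, y]) (xs := !₂[u, v]) (n := !₂[a, b])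
      hw fun r hr => by
        convert h r hr using 1
        ext i <;> fin_cases i <;> simp [pt]
    simpa [inner_plane] using hn
  have h₁ := hray (a := 1) (b := 1) fun r hr => hR (0 + r * 1) (1 + r * 1) (by linarith)
    (by linarith) (by linarith)
  have h₂ := hray (a := 1) (b := -1) fun r hr => hR (0 + r * 1) (-1 + r * -1) (by linarith)
    (by linarith) (by linarith)
  have h₃ := hray (a := -1) (b := -1) fun r hr => hL (-2 + r * -1) (-2 + r * -1) (by linarith)
    (by linarith) (by linarith)
  have h₄ := hray (a := -1) (b := 1) fun r hr => hL (-2 + r * -1) (0 + r * 1) (by linarith)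
    (by linarith) (by linarith)
  rw [mem_diamond_iff]
  refine ⟨?_, ?_, ?_, ?_⟩ <;> linarith

end Regions

section Construction

variable {x y u v : ℝ} {P : Set Plane}

/-- The graph consisting of the starting points and of the images under `T6` of the points of `P`:
the operators `T₀, …, T₅` of the construction are of this form. -/
def partialT6 (P : Set Plane) : Set (Plane × Plane) :=
  {z | z ∈ startPoints} ∪ {w ∈ T6 | w.1 ∈ P}

theorem startPoints_subset_T6 : {z | z ∈ startPoints} ⊆ T6 := by
  simp only [startPoints, List.mem_cons, List.not_mem_nil, or_false]
  rintro _ (rfl | rfl | rfl | rfl | rfl)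
  · exact rule_center rfl (by norm_num) (by norm_num)
  · exact rule_right le_rfl (by simp) (by simp)
  · exact rule_top le_rfl (by simp) (by simp)
  · exact rule_left le_rfl le_rfl (by norm_num)
  · exact rule_bottom le_rfl (by simp) (by simp)

theorem partialT6_subset_T6 : partialT6 P ⊆ T6 :=
  Set.union_subset startPoints_subset_T6 fun _ hw => hw.1

theorem pt_mem_partialT6 (hP : !₂[x, y] ∈ P) (h : Rule x y u v) : pt x y u v ∈ partialT6 P :=
  .inr ⟨h, hP⟩

theorem polarStep_partialT6 (h : ∀ u v, pt x y u v ∈ polar 2 (partialT6 P) → Rule x y u v) :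
    polarStep 2 (partialT6 P) !₂[x, y] = partialT6 (insert !₂[x, y] P) :=
  polarStep_union_fibers isCyclicallyMonotone_T6 startPoints_subset_T6 fun xs hxs => by
    have heta := pt_eta (!₂[x, y], xs)
    exact h (xs 0) (xs 1) (by rw [← heta] at hxs; exact hxs)

theorem right_mem_partialT6 : pt 1 0 0 1 ∈ partialT6 P :=
  .inl (by simp [startPoints, pt])

theorem top_mem_partialT6 : pt 0 1 (-1) 0 ∈ partialT6 P :=
  .inl (by simp [startPoints, pt])

theorem left_mem_partialT6 : pt (-1) 0 (-2) (-2) ∈ partialT6 P :=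
  .inl (by simp [startPoints, pt])

theorem bottom_mem_partialT6 : pt 0 (-1) 0 (-1) ∈ partialT6 P :=
  .inl (by simp [startPoints, pt])

theorem foldl_startPoints {α : Type*} (f : α → Plane → α) (a : α) :
    startPoints.foldl (fun b z => f b z.1) a =
      f (f (f (f (f a !₂[0, 0]) !₂[1, 0]) !₂[0, 1]) !₂[-1, 0]) !₂[0, -1] :=
  rfl

theorem foldl_polarStep_startPoints :
    startPoints.foldl (fun T z => polarStep 2 T z.1) {z | z ∈ startPoints} =
      partialT6 {!₂[0, -1], !₂[-1, 0], !₂[0, 1], !₂[1, 0], !₂[0, 0]} := by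
  have hstart : {z | z ∈ startPoints} = partialT6 ∅ := by simp [partialT6]
  have hcenter := polarStep_partialT6 (P := ∅) fun _ _ h =>
    rule_center_of_mem_polar h right_mem_partialT6 top_mem_partialT6 left_mem_partialT6
      bottom_mem_partialT6
  rw [LawfulSingleton.insert_empty_eq] at hcenter
  have hright := polarStep_partialT6 (P := {!₂[0, 0]}) fun _ _ h =>
    rule_right_of_mem_polar h (pt_mem_partialT6 (by simp) (rule_center rfl le_rfl (by simp)))
      top_mem_partialT6 bottom_mem_partialT6
  have htop := polarStep_partialT6 (P := {!₂[1, 0], !₂[0, 0]}) fun _ _ h =>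
    rule_top_of_mem_polar h (pt_mem_partialT6 (by simp) (rule_center rfl (by simp) le_rfl))
      right_mem_partialT6 top_mem_partialT6 left_mem_partialT6 bottom_mem_partialT6
  have hleft := polarStep_partialT6 (P := {!₂[0, 1], !₂[1, 0], !₂[0, 0]}) fun _ _ h =>
    rule_left_of_mem_polar h (pt_mem_partialT6 (by simp) (rule_center rfl le_rfl (by simp)))
      (pt_mem_partialT6 (by simp) (rule_center rfl (by simp) le_rfl))
      (pt_mem_partialT6 (by simp) (rule_top le_rfl (by simp) (by simp))) bottom_mem_partialT6
  have hbottom := polarStep_partialT6 (P := {!₂[-1, 0], !₂[0, 1], !₂[1, 0], !₂[0, 0]})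
    fun _ _ h => rule_bottom_of_mem_polar h
      (pt_mem_partialT6 (by simp) (rule_center rfl le_rfl (by simp)))
      (pt_mem_partialT6 (by simp) (rule_right le_rfl (by simp) (by simp))) left_mem_partialT6
  rw [hstart, foldl_startPoints, hcenter, hright, htop, hleft, hbottom]

theorem vertices_subset_partialT6 :
    vertices ⊆ partialT6 {!₂[0, -1], !₂[-1, 0], !₂[0, 1], !₂[1, 0], !₂[0, 0]} := by
  rintro _ (rfl | rfl | rfl | rfl | rfl | rfl | rfl | rfl | rfl | rfl) <;>
    refine pt_mem_partialT6 (by simp) ?_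
  · exact rule_center rfl le_rfl (by simp)
  · exact rule_center rfl (by simp) le_rfl
  · exact rule_right le_rfl (by simp) (by simp)
  · exact rule_right le_rfl (by simp) (by simp)
  · exact rule_top le_rfl (by simp) (by simp)
  · exact rule_top le_rfl (by simp) (by simp)
  · exact rule_left le_rfl le_rfl (by norm_num)
  · exact rule_left le_rfl (by simp) (by simp)
  · exact rule_bottom le_rfl (by simp) (by simp)
  · exact rule_bottom le_rfl le_rfl (by simp)

theorem polar_partialT6 :
    polar 2 (partialT6 {!₂[0, -1], !₂[-1, 0], !₂[0, 1], !₂[1, 0], !₂[0, 0]}) = T6 := by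
  refine Set.Subset.antisymm (fun w hw => ?_)
    (isCyclicallyMonotone_T6.subset_polar partialT6_subset_T6)
  exact mem_T6_of_mem_polar_vertices (polar_anti vertices_subset_partialT6 hw)
    (fst_mem_diamond_of_mem_polar hw
      (fun _ _ hu hv hv' => pt_mem_partialT6 (by simp) (rule_right hu hv hv'))
      fun _ _ hu hv hv' => pt_mem_partialT6 (by simp) (rule_left hu hv hv'))

theorem lastStep_startPoints : lastStep 2 startPoints = T6 := by
  rw [lastStep, foldl_polarStep_startPoints, polar_partialT6]

theorem isMaximalCyclicallyMonotone_T6 : IsMaximalCyclicallyMonotone 2 T6 := by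
  refine isMaximalCyclicallyMonotone_of_polar_eq (Set.Subset.antisymm ?_
    (isCyclicallyMonotone_T6.subset_polar subset_rfl))
  exact (polar_anti partialT6_subset_T6).trans polar_partialT6.subset

end Construction

theorem mem_dom_T6_iff {z : Plane} : z ∈ dom T6 ↔
    |z 0| + |z 1| = 1 ∨ 0 ≤ z 0 ∧ z 0 ≤ z 1 ∧ z 1 ≤ 1 - z 0 ∨
      -1 - z 0 ≤ z 1 ∧ z 1 ≤ z 0 ∧ z 0 ≤ 0 := by
  have hcoord : z ∈ dom T6 ↔ (∃ u v, UpperRule (z 0) (z 1) u v) ∨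
      ∃ u v, UpperRule (-z 0) (-z 1) u v := by
    constructor
    · rintro ⟨xs, h⟩
      exact (rule_iff_upperRule.1 h).imp (fun h => ⟨_, _, h⟩) fun h => ⟨_, _, h⟩
    · rintro (⟨u, v, h⟩ | ⟨u, v, h⟩)
      · exact ⟨!₂[u, v], h.rule⟩
      · exact ⟨!₂[-2 - u, -1 - v], UpperRule.rule_of_reflect (by simpa using h)⟩
  rw [hcoord, exists_upperRule_iff, exists_upperRule_iff, abs_neg]
  generalize z 0 = x, z 1 = y
  obtain hy | hy := le_total 0 y
  · rw [abs_of_nonneg hy]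
    grind
  · rw [abs_of_nonpos hy]
    grind

theorem dom_T6 : dom T6 = {z : Plane | |z 0| + |z 1| = 1} ∪
    {z : Plane | z 0 = 0 ∧ -1 < z 1 ∧ z 1 < 1} ∪
    {z : Plane | 0 ≤ z 0 ∧ z 0 ≤ z 1 ∧ z 1 ≤ 1 - z 0} ∪
    {z : Plane | -1 - z 0 ≤ z 1 ∧ z 1 ≤ z 0 ∧ z 0 ≤ 0} := by
  ext z
  simp only [mem_dom_T6_iff, Set.mem_union, Set.mem_ofPred_eq]
  grind

theorem not_maximal_isMonotone_T6 : ¬ Maximal IsMonotone T6 := by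
  have hdiamond : (pt (1 / 2) 0 (-1 / 2) (-1 / 2)).1 ∈ diamond := by norm_num [diamond, pt]
  have hcore : ∀ k ∈ core, 0 ≤ inner ℝ ((pt (1 / 2) 0 (-1 / 2) (-1 / 2)).1 - k.1)
      ((pt (1 / 2) 0 (-1 / 2) (-1 / 2)).2 - k.2) := by
    intro k hk
    obtain ⟨c, hc, rfl⟩ := exists_coreCoordinates hk
    have h : 0 ≤ (1 - c.1) * (-1 - 2 * c.2.2.1) + (0 - c.2.1) * (-1 - 2 * c.2.2.2) := by
      clear hk
      revert c
      decide
    rify at h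
    simp only [inner_plane, pt, PiLp.sub_apply, Matrix.cons_val_zero, Matrix.cons_val_one]
    linarith
  refine not_maximal_isMonotone_of_notMem isCyclicallyMonotone_T6.isMonotone
    (w := pt (1 / 2) 0 (-1 / 2) (-1 / 2)) (fun h => ?_)
    fun z hz => inner_sub_nonneg_of_mem_cyclicHull hdiamond hcore (T6_subset_cyclicHull hz)
  have hdom := mem_dom_T6_iff.1 ⟨_, h⟩
  norm_num [pt] at hdom

end CyclicMono

theorem mainTheorem9 :
    CyclicMono.lastStep 2 CyclicMono.startPoints = CyclicMono.T6 ∧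
    CyclicMono.dom CyclicMono.T6 =
      {z : CyclicMono.Plane | |z 0| + |z 1| = 1} ∪
      {z : CyclicMono.Plane | z 0 = 0 ∧ -1 < z 1 ∧ z 1 < 1} ∪
      {z : CyclicMono.Plane | 0 ≤ z 0 ∧ z 0 ≤ z 1 ∧ z 1 ≤ 1 - z 0} ∪
      {z : CyclicMono.Plane | -1 - z 0 ≤ z 1 ∧ z 1 ≤ z 0 ∧ z 0 ≤ 0} ∧
    CyclicMono.IsMaximalCyclicallyMonotone 2 CyclicMono.T6 ∧
    ¬ Maximal CyclicMono.IsMonotone CyclicMono.T6 :=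
  ⟨CyclicMono.lastStep_startPoints, CyclicMono.dom_T6, CyclicMono.isMaximalCyclicallyMonotone_T6,
    CyclicMono.not_maximal_isMonotone_T6⟩
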